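/- Let $R$ be a discrete valuation ring with field of fractions $K$, let $n \ge 0$, and let $G \subseteq \mathrm{GL}_n(R)$ be a finite pseudoreflection group, that is, a finite subgroup generated by pseudoreflections: elements $\sigma \in G$ whose fixed space $\{v \in K^n : \sigma v = v\}$ has $K$-dimension $n-1$. Let $G$ act on $R[x_1,\dots,x_n]$ by $R$-algebra automorphisms via $(\sigma\cdot f)(a) = f(\sigma^{-1}a)$ for $a\in R^n$. If $|G|$ is invertible in $R$, then the ring of invariants $R[x_1,\dots,x_n]^G$, graded by total degree, is a polynomial ring in $n$ variables: there are positive integers $d_1,\dots,d_n$ and an isomorphism of graded $R$-algebras $R[y_1,\dots,y_n] \cong R[x_1,\dots,x_n]^G$, where $y_i$ has degree $d_i$. -/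

import Mathlib

/-- A matrix `σ ∈ GL_n(R)` over a domain `R` with fraction field `K` is a pseudoreflection if its
fixed space `{v ∈ K^n | σ v = v}` is a hyperplane, i.e. has `K`-dimension `n - 1`
(in particular `σ ≠ 1`). -/
def IsPseudoreflection {R : Type*} [CommRing R] [IsDomain R] {n : ℕ}
    (σ : Matrix.GeneralLinearGroup (Fin n) R) : Prop :=
  Module.finrank (FractionRing R)
    (LinearMap.ker (Matrix.toLin' (σ.val.map (algebraMap R (FractionRing R)) - 1))) + 1 = n

/-- A subgroup of `GL_n(R)` is a pseudoreflection group if it is generated by the pseudoreflections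
that it contains. -/
def IsPseudoreflectionGroup {R : Type*} [CommRing R] [IsDomain R] {n : ℕ}
    (G : Subgroup (Matrix.GeneralLinearGroup (Fin n) R)) : Prop :=
  Subgroup.closure {σ | σ ∈ G ∧ IsPseudoreflection σ} = G

/-- The action of `σ ∈ GL_n(R)` on `R[x_1, …, x_n]` with `(σ · f)(a) = f (σ⁻¹ a)`: the variable `x_i`
goes to the `i`-th coordinate `∑ j, (σ⁻¹)_{ij} x_j` of `σ⁻¹ x`. -/
noncomputable def polyAct {R : Type*} [CommRing R] {n : ℕ}
    (σ : Matrix.GeneralLinearGroup (Fin n) R) :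
    MvPolynomial (Fin n) R →ₐ[R] MvPolynomial (Fin n) R :=
  MvPolynomial.aeval fun i => ∑ j, MvPolynomial.C ((σ⁻¹).val i j) * MvPolynomial.X j

theorem eval_polyAct {R : Type*} [CommRing R] {n : ℕ}
    (σ : Matrix.GeneralLinearGroup (Fin n) R) (f : MvPolynomial (Fin n) R) (a : Fin n → R) :
    MvPolynomial.eval a (polyAct σ f) = MvPolynomial.eval (Matrix.mulVec (σ⁻¹).val a) f := by
  induction f using MvPolynomial.induction_on with
  | C r => simp [polyAct]
  | add p q hp hq => simp [hp, hq]
  | mul_X p i hp =>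
    rw [map_mul, map_mul, map_mul, hp]
    simp [polyAct, Matrix.mulVec, dotProduct]

/-- The ring of invariants `R[x_1, …, x_n]^G`. -/
noncomputable def invariantRing {R : Type*} [CommRing R] {n : ℕ}
    (G : Subgroup (Matrix.GeneralLinearGroup (Fin n) R)) :
    Subalgebra R (MvPolynomial (Fin n) R) :=
  ⨅ σ ∈ G, AlgHom.equalizer (polyAct σ) (AlgHom.id R (MvPolynomial (Fin n) R))

theorem mem_invariantRing {R : Type*} [CommRing R] {n : ℕ}
    (G : Subgroup (Matrix.GeneralLinearGroup (Fin n) R)) (f : MvPolynomial (Fin n) R) :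
    f ∈ invariantRing G ↔ ∀ σ ∈ G, polyAct σ f = f := by
  simp [invariantRing, Algebra.mem_iInf, AlgHom.mem_equalizer]

/-- A subalgebra `S` of `R[x_1, …, x_n]`, graded by the total degree, is a polynomial ring in `n`
variables: for some positive weights `d_1, …, d_n` there is an isomorphism of graded `R`-algebras
from `R[y_1, …, y_n]`, graded by `deg y_i = d_i`, onto `S`. -/
def IsGradedPolynomialRing {R : Type*} [CommRing R] {n : ℕ}
    (S : Subalgebra R (MvPolynomial (Fin n) R)) : Prop :=
  ∃ d : Fin n → ℕ, (∀ i, 0 < d i) ∧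
    ∃ e : MvPolynomial (Fin n) R ≃ₐ[R] S,
      ∀ (p : MvPolynomial (Fin n) R) (m : ℕ),
        MvPolynomial.IsWeightedHomogeneous d p m ↔
          MvPolynomial.IsHomogeneous (e p : MvPolynomial (Fin n) R) m

/-!
The argument works directly over the local ring `R`, with residue field `k`. Let `S = R[x₁, …, xₙ]`
and `A = S^G`, let `A₊` be the ideal of the invariants without constant term, and `𝔫` the maximal
ideal of the invariants with constant term in the maximal ideal of `R`; so `A / 𝔫 = k`. The heart
of the matter is that `A₊ / 𝔫 A₊` has dimension at most `n` over `k`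
(`exists_sum_mul_mem_smul_irrelevant`).

The Euler map `(w₁, …, wₙ) ↦ ∑ xₖ wₖ`, that is, contraction of the `1`-form `∑ wₖ dxₖ` with the
Euler vector field, is a `G`-equivariant surjection from `Sⁿ` onto the ideal `(x₁, …, xₙ)`. As `|G|`
is invertible, it stays surjective on invariants (`exists_equivariant_sum_X_mul_eq`): `A₊` is a
quotient of the `A`-module `Ω` of invariant `1`-forms. Any `n + 1` elements `wᵢ` of `Ω` satisfy a
nontrivial relation over `S`, hence one over `A` (`exists_invariant_relation`), say `∑ aᵢ wᵢ = 0`.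
By Nakayama's lemma the ideal `(aᵢ)` has the simple quotient `k`, in which `aᵢ ↦ cᵢ`, not all zero
(`exists_ideal_of_ne_zero`). As `S` is flat over `A` at `𝔫`, it follows that
`∑ cᵢ wᵢ ∈ 𝔫 Sⁿ`; applying the Euler map and averaging, `∑ cᵢ αᵢ ∈ 𝔫 A₊` for the images `αᵢ` of the
`wᵢ`.

The only consequence of flatness that is needed is `mem_smul_top_of_smul_mem_smul_top`, and this is
where pseudoreflections enter: `τ f - f` is divisible by a linear form, and the quotient is an
`A`-linear function of `f` of smaller degree (`exists_dividedDifference`), which allows an induction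
on the degree as in Chevalley's proof for reflection groups.

Homogeneous invariants which form a basis of `A₊ / 𝔫 A₊` generate the `R`-algebra `A`, by Nakayama's
lemma in each degree (`adjoin_eq_invariantRing`). There are at most `n` of them and `S` is integral
over `A`, so by transcendence degree there are exactly `n` and they are algebraically independent
(`isGradedPolynomialRing_of_adjoin_eq`). No derivatives are taken, so it does not matter whether
the degrees of the invariants are invertible in `R`.
-/

open MvPolynomial

/-! ### The action on polynomials -/

section Action

variable {R : Type*} [CommRing R] {n : ℕ}

theorem polyAct_X (σ : Matrix.GeneralLinearGroup (Fin n) R) (i : Fin n) :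
    polyAct σ (X i) = ∑ j, C ((σ⁻¹).val i j) * X j := by
  simp [polyAct]

theorem polyAct_one : polyAct (1 : Matrix.GeneralLinearGroup (Fin n) R) = AlgHom.id R _ := by
  refine MvPolynomial.algHom_ext fun i => ?_
  simp [polyAct_X, Matrix.one_apply]

theorem polyAct_mul (σ τ : Matrix.GeneralLinearGroup (Fin n) R) (f : MvPolynomial (Fin n) R) :
    polyAct (σ * τ) f = polyAct σ (polyAct τ f) := by
  suffices h : polyAct (σ * τ) = (polyAct σ).comp (polyAct τ) by rw [h]; rfl
  refine MvPolynomial.algHom_ext fun i => ?_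
  simp only [AlgHom.comp_apply, polyAct_X, map_sum, map_mul, mul_inv_rev, Units.val_mul,
    Matrix.mul_apply, algHom_C, Finset.sum_mul, Finset.mul_sum]
  rw [Finset.sum_comm]
  simp [mul_assoc, MvPolynomial.algebraMap_eq]

theorem polyAct_inv_polyAct (σ : Matrix.GeneralLinearGroup (Fin n) R)
    (f : MvPolynomial (Fin n) R) : polyAct σ⁻¹ (polyAct σ f) = f := by
  rw [← polyAct_mul, inv_mul_cancel, polyAct_one, AlgHom.id_apply]

theorem polyAct_injective (σ : Matrix.GeneralLinearGroup (Fin n) R) :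
    Function.Injective (polyAct σ) :=
  Function.LeftInverse.injective (polyAct_inv_polyAct σ)

theorem MvPolynomial.IsHomogeneous.polyAct {f : MvPolynomial (Fin n) R} {d : ℕ}
    (hf : f.IsHomogeneous d) (σ : Matrix.GeneralLinearGroup (Fin n) R) :
    (polyAct σ f).IsHomogeneous d := by
  have := hf.aeval (fun i => ∑ j, C ((σ⁻¹).val i j) * X j) (n := 1) fun i =>
    IsHomogeneous.sum _ _ _ fun j _ => isHomogeneous_C_mul_X _ _
  rwa [one_mul] at this

/-- A linear endomorphism preserving homogeneity of every degree commutes with the projections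
to the homogeneous components. -/
theorem homogeneousComponent_map_of_isHomogeneous {ι κ : Type*}
    (φ : MvPolynomial ι R →ₗ[R] MvPolynomial κ R)
    (hφ : ∀ f d, f.IsHomogeneous d → (φ f).IsHomogeneous d) (d : ℕ) (f : MvPolynomial ι R) :
    homogeneousComponent d (φ f) = φ (homogeneousComponent d f) := by
  conv_lhs => rw [← sum_homogeneousComponent f, map_sum, map_sum]
  rw [Finset.sum_congr rfl fun i _ => homogeneousComponent_of_mem
    (hφ _ i (homogeneousComponent_isHomogeneous i f))]
  rw [Finset.sum_ite_eq]
  split_ifs with h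
  · rfl
  · rw [homogeneousComponent_eq_zero _ _ (by simpa using h), map_zero]

theorem homogeneousComponent_polyAct (σ : Matrix.GeneralLinearGroup (Fin n) R) (d : ℕ)
    (f : MvPolynomial (Fin n) R) :
    homogeneousComponent d (polyAct σ f) = polyAct σ (homogeneousComponent d f) :=
  homogeneousComponent_map_of_isHomogeneous (polyAct σ).toLinearMap
    (fun _ _ hf => hf.polyAct σ) d f

theorem totalDegree_polyAct_le (σ : Matrix.GeneralLinearGroup (Fin n) R)
    (f : MvPolynomial (Fin n) R) : (polyAct σ f).totalDegree ≤ f.totalDegree := by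
  conv_lhs => rw [← sum_homogeneousComponent f, map_sum]
  refine totalDegree_finsetSum_le fun i hi => ?_
  exact ((homogeneousComponent_isHomogeneous i f).polyAct σ).totalDegree_le.trans
    (by simpa [Nat.lt_succ_iff] using hi)

theorem constantCoeff_polyAct (σ : Matrix.GeneralLinearGroup (Fin n) R)
    (f : MvPolynomial (Fin n) R) : constantCoeff (polyAct σ f) = constantCoeff f := by
  have h := homogeneousComponent_polyAct σ 0 f
  simpa [homogeneousComponent_zero, algHom_C, MvPolynomial.algebraMap_eq,
    MvPolynomial.constantCoeff_eq] using h

end Action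

/-! ### Averaging over the group -/

section Reynolds

variable {R : Type*} [CommRing R] {n : ℕ} (G : Subgroup (Matrix.GeneralLinearGroup (Fin n) R))

theorem polyAct_coe_invariantRing {σ : Matrix.GeneralLinearGroup (Fin n) R} (hσ : σ ∈ G)
    (a : invariantRing G) : polyAct σ (a : MvPolynomial (Fin n) R) = a :=
  (mem_invariantRing G _).1 a.2 σ hσ

/-- The action of an element of `G` on polynomials is linear over the ring of invariants. -/
noncomputable def polyActLinear (σ : G) :
    MvPolynomial (Fin n) R →ₗ[invariantRing G] MvPolynomial (Fin n) R where
  toFun := polyAct σ.1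
  map_add' := map_add _
  map_smul' a f := by
    simp [Algebra.smul_def, polyAct_coe_invariantRing G σ.2]

@[simp]
theorem polyActLinear_apply (σ : G) (f : MvPolynomial (Fin n) R) :
    polyActLinear G σ f = polyAct σ.1 f := rfl

variable [Fintype G] (hG : IsUnit (Nat.card G : R))

theorem sum_subgroup_mul_left {H M : Type*} [Group H] [AddCommMonoid M] (G : Subgroup H)
    [Fintype G] {τ : H} (hτ : τ ∈ G) (F : H → M) : ∑ σ : G, F (τ * σ.1) = ∑ σ : G, F σ.1 :=
  Fintype.sum_equiv (Equiv.mulLeft (⟨τ, hτ⟩ : G)) _ _ fun _ => rfl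

theorem average_mem_invariantRing (r : R) (f : MvPolynomial (Fin n) R) :
    C r * ∑ σ : G, polyAct σ.1 f ∈ invariantRing G := by
  rw [mem_invariantRing]
  intro τ hτ
  rw [map_mul, map_sum, algHom_C, MvPolynomial.algebraMap_eq]
  simp_rw [← polyAct_mul]
  rw [sum_subgroup_mul_left G hτ fun σ => polyAct σ f]

/-- The Reynolds operator: the average over `G` of the translates of a polynomial, as a linear map
over the ring of invariants. -/
noncomputable def reynolds : MvPolynomial (Fin n) R →ₗ[invariantRing G] invariantRing G where
  toFun f := ⟨C (hG.unit⁻¹ : Rˣ).val * ∑ σ : G, polyAct σ.1 f, average_mem_invariantRing G _ f⟩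
  map_add' f g := by
    ext1
    simp [Finset.sum_add_distrib, mul_add]
  map_smul' a f := by
    ext1
    simp [Algebra.smul_def, polyAct_coe_invariantRing, ← Finset.mul_sum, mul_left_comm]

theorem coe_reynolds (f : MvPolynomial (Fin n) R) :
    (reynolds G hG f : MvPolynomial (Fin n) R) = C (hG.unit⁻¹ : Rˣ).val * ∑ σ : G, polyAct σ.1 f := rfl

theorem C_inv_card_mul_card_mul (f : MvPolynomial (Fin n) R) :
    C (hG.unit⁻¹ : Rˣ).val * ((Fintype.card G : MvPolynomial (Fin n) R) * f) = f := by
  rw [← mul_assoc, ← Nat.card_eq_fintype_card, ← map_natCast (C (σ := Fin n) (R := R)), ← map_mul,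
    IsUnit.val_inv_mul, map_one, one_mul]

@[simp]
theorem reynolds_coe (a : invariantRing G) : reynolds G hG (a : MvPolynomial (Fin n) R) = a := by
  ext1
  rw [coe_reynolds, Finset.sum_congr rfl fun σ _ => polyAct_coe_invariantRing G σ.2 a,
    Finset.sum_const, Finset.card_univ, nsmul_eq_mul, C_inv_card_mul_card_mul]

theorem constantCoeff_reynolds (f : MvPolynomial (Fin n) R) :
    constantCoeff (reynolds G hG f : MvPolynomial (Fin n) R) = constantCoeff f := by
  have h := congrArg constantCoeff (C_inv_card_mul_card_mul G hG f)
  rw [coe_reynolds]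
  simpa [constantCoeff_polyAct] using h

/-- A polynomial which modulo a submodule `N` agrees with all its translates agrees modulo `N`
with its average. -/
theorem sub_reynolds_mem (N : Submodule (invariantRing G) (MvPolynomial (Fin n) R))
    {f : MvPolynomial (Fin n) R} (hf : ∀ σ ∈ G, polyAct σ f - f ∈ N) :
    f - reynolds G hG f ∈ N := by
  have h : ∑ σ : G, (polyAct σ.1 f - f) ∈ N := N.sum_mem fun σ _ => hf σ.1 σ.2
  have h2 := N.smul_mem (algebraMap R (invariantRing G) (-(hG.unit⁻¹ : Rˣ).val)) h
  convert h2 using 1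
  rw [Algebra.smul_def, Finset.sum_sub_distrib, coe_reynolds]
  conv_lhs => rw [← C_inv_card_mul_card_mul G hG f]
  have : algebraMap (invariantRing G) (MvPolynomial (Fin n) R)
      (algebraMap R (invariantRing G) (-(hG.unit⁻¹ : Rˣ).val)) = C (-(hG.unit⁻¹ : Rˣ).val) := rfl
  rw [this]
  simp only [C_inv_card_mul_card_mul G hG f, Finset.sum_const, Finset.card_univ, nsmul_eq_mul,
    map_neg, mul_sub, neg_mul]
  ring

end Reynolds

/-! ### Pseudoreflections and divided differences -/

/-- In a matrix of rank one the `2 × 2` minors vanish. -/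
theorem mul_eq_mul_of_finrank_ker_add_one {K : Type*} [Field K] {n : ℕ}
    {M : Matrix (Fin n) (Fin n) K}
    (h : Module.finrank K (LinearMap.ker (Matrix.toLin' M)) + 1 = n) (i i' j j' : Fin n) :
    M i j * M i' j' = M i j' * M i' j := by
  have h1 := LinearMap.finrank_range_add_finrank_ker (Matrix.toLin' M)
  rw [Module.finrank_fin_fun] at h1
  obtain ⟨v, hv⟩ := finrank_le_one_iff.1
    (show Module.finrank K (LinearMap.range (Matrix.toLin' M)) ≤ 1 by omega)
  have hcol (k : Fin n) : ∃ c : K, ∀ i, M i k = c * v.1 i := by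
    obtain ⟨c, hc⟩ := hv ⟨_, LinearMap.mem_range_self (Matrix.toLin' M) (Pi.single k 1)⟩
    refine ⟨c, fun i => ?_⟩
    have := congrFun (congrArg Subtype.val hc) i
    simpa [eq_comm] using this
  obtain ⟨c, hc⟩ := hcol j
  obtain ⟨c', hc'⟩ := hcol j'
  rw [hc, hc', hc, hc']
  ring

/-- Over a discrete valuation ring, a matrix of rank one is the product of a column and a row. -/
theorem exists_eq_mul_of_finrank_ker_add_one {R : Type*} [CommRing R] [IsDomain R]
    [IsDiscreteValuationRing R] {n : ℕ} (M : Matrix (Fin n) (Fin n) R)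
    (h : Module.finrank (FractionRing R)
      (LinearMap.ker (Matrix.toLin' (M.map (algebraMap R (FractionRing R))))) + 1 = n) :
    ∃ u w : Fin n → R, w ≠ 0 ∧ ∀ i j, M i j = u i * w j := by
  have hminor (i i' j j' : Fin n) : M i j * M i' j' = M i j' * M i' j := by
    apply IsFractionRing.injective R (FractionRing R)
    simpa using mul_eq_mul_of_finrank_ker_add_one h i i' j j'
  obtain ⟨i₁, j₀, h₁⟩ : ∃ i j, M i j ≠ 0 := by
    by_contra! h0
    have : M = 0 := by ext i j; exact h0 i j
    subst this
    have hzero : (0 : Matrix (Fin n) (Fin n) R).map (algebraMap R (FractionRing R)) = 0 := by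
      ext i j
      simp
    rw [hzero, map_zero, LinearMap.ker_zero, finrank_top, Module.finrank_fin_fun] at h
    omega
  -- a row through a nonzero entry of least valuation in its column divides all the others
  obtain ⟨i₀, -, h₀⟩ := Finset.exists_min_image Finset.univ
    (fun i => IsDiscreteValuationRing.addVal R (M i j₀)) ⟨i₁, Finset.mem_univ _⟩
  have hdvd (i : Fin n) : M i₀ j₀ ∣ M i j₀ :=
    IsDiscreteValuationRing.addVal_le_iff_dvd.1 (h₀ i (Finset.mem_univ _))
  have hne : M i₀ j₀ ≠ 0 := fun h0 => h₁ (zero_dvd_iff.1 (h0 ▸ hdvd i₁))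
  choose u hu using hdvd
  refine ⟨u, M i₀, fun h0 => hne (congrFun h0 j₀), fun i j => mul_left_cancel₀ hne ?_⟩
  rw [hminor i₀ i j₀ j, hu i]
  ring

/-- Divided differences: if `τ⁻¹` is a pseudoreflection, then for a suitable linear form `l` vanishing on
its fixed hyperplane `f ↦ (τ f - f) / l` is defined, linear over the invariants, and lowers the
degree. -/
theorem exists_dividedDifference {R : Type*} [CommRing R] [IsDomain R]
    [IsDiscreteValuationRing R] {n : ℕ} (G : Subgroup (Matrix.GeneralLinearGroup (Fin n) R))
    (τ : G) (hτ : IsPseudoreflection (τ⁻¹).1) :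
    ∃ (l : MvPolynomial (Fin n) R)
      (D : MvPolynomial (Fin n) R →ₗ[invariantRing G] MvPolynomial (Fin n) R),
      ∀ f, polyAct τ.1 f - f = l * D f ∧ (D f = 0 ∨ (D f).totalDegree < f.totalDegree) := by
  obtain ⟨u, w, hw, hM⟩ := exists_eq_mul_of_finrank_ker_add_one ((τ⁻¹).1.val - 1) (by
    have hmap : ((τ⁻¹).1.val - 1).map (algebraMap R (FractionRing R)) =
        (τ⁻¹).1.val.map (algebraMap R (FractionRing R)) - 1 := by
      rw [Matrix.map_sub _ (map_sub _), Matrix.map_one _ (map_zero _) (map_one _)]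
    rw [hmap]
    exact hτ)
  set l : MvPolynomial (Fin n) R := ∑ j, C (w j) * X j with hl
  have hlhom : l.IsHomogeneous 1 := IsHomogeneous.sum _ _ _ fun j _ => isHomogeneous_C_mul_X _ _
  have hl0 : l ≠ 0 := by
    obtain ⟨j, hj⟩ := Function.ne_iff.1 hw
    refine fun h0 => hj ?_
    have := congrArg (eval (Pi.single j 1)) h0
    simpa [hl, Pi.single_apply] using this
  have hX (i : Fin n) : polyAct τ.1 (X i) - X i = l * C (u i) := by
    have (j : Fin n) : ((τ⁻¹).1.val i j) = u i * w j + (1 : Matrix (Fin n) (Fin n) R) i j := by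
      rw [← hM, Matrix.sub_apply, sub_add_cancel]
    rw [polyAct_X]
    change ∑ j, C ((τ⁻¹).1.val i j) * X j - X i = _
    simp only [this, map_add, map_mul, add_mul, Finset.sum_add_distrib, hl, Finset.sum_mul]
    simp [Matrix.one_apply, apply_ite, mul_comm, mul_left_comm]
  have hdvd (f : MvPolynomial (Fin n) R) : l ∣ polyAct τ.1 f - f := by
    rw [← Ideal.mem_span_singleton, ← Ideal.Quotient.mk_eq_mk_iff_sub_mem]
    have : (Ideal.Quotient.mkₐ R (Ideal.span {l})).comp (polyAct τ.1) =
        Ideal.Quotient.mkₐ R (Ideal.span {l}) := by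
      refine MvPolynomial.algHom_ext fun i => ?_
      simp only [AlgHom.comp_apply, Ideal.Quotient.mkₐ_eq_mk]
      rw [Ideal.Quotient.mk_eq_mk_iff_sub_mem, Ideal.mem_span_singleton, hX]
      exact dvd_mul_right _ _
    exact DFunLike.congr_fun this f
  choose D hD using hdvd
  refine ⟨l, { toFun := D, map_add' := ?_, map_smul' := ?_ }, fun f => ⟨hD f, ?_⟩⟩
  · intro f g
    apply mul_left_cancel₀ hl0
    rw [mul_add, ← hD, ← hD, ← hD, map_add]
    ring
  · intro a f
    apply mul_left_cancel₀ hl0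
    rw [RingHom.id_apply, mul_smul_comm, ← hD, ← hD, smul_sub]
    exact congrArg (· - _) ((polyActLinear G τ).map_smul a f)
  · refine or_iff_not_imp_left.2 fun h0 => ?_
    have h1 : (polyAct τ.1 f - f).totalDegree = (l * D f).totalDegree := by rw [← hD]
    replace h0 : D f ≠ 0 := h0
    rw [totalDegree_mul_of_isDomain hl0 h0, hlhom.totalDegree hl0] at h1
    have h2 := totalDegree_sub (polyAct τ.1 f) f
    rw [max_eq_right (totalDegree_polyAct_le _ _)] at h2
    change (D f).totalDegree < _
    omega

/-! ### A flatness criterion over the ring of invariants -/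

section Ideals

variable {R : Type*} [CommRing R] {n : ℕ} (G : Subgroup (Matrix.GeneralLinearGroup (Fin n) R))

/-- Evaluation of an invariant at the origin. -/
noncomputable def invariantConstantCoeff : invariantRing G →+* R :=
  constantCoeff.comp (algebraMap (invariantRing G) (MvPolynomial (Fin n) R))

theorem invariantConstantCoeff_surjective : Function.Surjective (invariantConstantCoeff G) :=
  fun r => ⟨algebraMap R _ r, constantCoeff_C _ r⟩

/-- The ideal of the invariants without constant term. -/
noncomputable def invariantIrrelevant : Ideal (invariantRing G) :=
  RingHom.ker (invariantConstantCoeff G)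

/-- The ideal of the invariants whose constant term lies in the maximal ideal of the local ring
`R`. -/
noncomputable def invariantMaximalIdeal [IsLocalRing R] : Ideal (invariantRing G) :=
  (IsLocalRing.maximalIdeal R).comap (invariantConstantCoeff G)

instance [IsLocalRing R] : (invariantMaximalIdeal G).IsMaximal :=
  Ideal.comap_isMaximal_of_surjective _ (invariantConstantCoeff_surjective G)

end Ideals

theorem LinearMap.apply_mem_smul_of_mem_smul {A M M' : Type*} [CommRing A] [AddCommGroup M]
    [Module A M] [AddCommGroup M'] [Module A M'] (φ : M →ₗ[A] M') (I : Ideal A)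
    {N : Submodule A M} {P : Submodule A M'} (hφ : ∀ y ∈ N, φ y ∈ P) {x : M} (hx : x ∈ I • N) :
    φ x ∈ I • P := by
  have h := Submodule.mem_map_of_mem (f := φ) hx
  rw [Submodule.map_smul''] at h
  exact Submodule.smul_mono le_rfl (Submodule.map_le_iff_le_comap.2 hφ) h

section Key

variable {R : Type*} [CommRing R] [IsDomain R] {n : ℕ}
  {G : Subgroup (Matrix.GeneralLinearGroup (Fin n) R)}

/-- To check that a polynomial is invariant modulo a stable submodule, it suffices to apply to it
the inverses of the pseudoreflections. -/
theorem polyAct_sub_mem_of_isPseudoreflectionGroup (hG : IsPseudoreflectionGroup G)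
    (N : Submodule (invariantRing G) (MvPolynomial (Fin n) R))
    (hN : ∀ σ ∈ G, ∀ f ∈ N, polyAct σ f ∈ N) {f : MvPolynomial (Fin n) R}
    (hf : ∀ σ ∈ G, IsPseudoreflection σ → polyAct σ⁻¹ f - f ∈ N) :
    ∀ σ ∈ G, polyAct σ f - f ∈ N := by
  have hinv : ∀ σ ∈ G, polyAct σ⁻¹ f - f ∈ N → polyAct σ f - f ∈ N := fun σ hσ h => by
    have := N.neg_mem (hN σ hσ _ h)
    rwa [map_sub, ← polyAct_mul, mul_inv_cancel, polyAct_one, AlgHom.id_apply, neg_sub] at this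
  intro σ hσ
  suffices h : σ ∈ G ∧ polyAct σ f - f ∈ N from h.2
  rw [← hG] at hσ
  induction hσ using Subgroup.closure_induction with
  | mem τ hτ => exact ⟨hτ.1, hinv τ hτ.1 (hf τ hτ.1 hτ.2)⟩
  | one => exact ⟨G.one_mem, by simp [polyAct_one]⟩
  | mul σ τ _ _ h₁ h₂ =>
    refine ⟨G.mul_mem h₁.1 h₂.1, ?_⟩
    have := N.add_mem (hN σ h₁.1 _ h₂.2) h₁.2
    rwa [map_sub, ← polyAct_mul, sub_add_sub_cancel] at this
  | inv σ _ h =>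
    exact ⟨G.inv_mem h.1, hinv _ (G.inv_mem h.1) (by rw [inv_inv]; exact h.2)⟩

variable [IsDiscreteValuationRing R] [Fintype G]

/-- The step which uses the pseudoreflections: if an invariant `a` lies outside the ideal `I` of
invariants, but is multiplied into `I` by the maximal ideal `𝔫`, then `a g ∈ I R[x]` forces
`g ∈ 𝔫 R[x]`. Divided differences are linear over the invariants, so by induction on the degree
they send `g` into `𝔫 R[x]`; hence `g` is invariant modulo `𝔫 R[x]`, and may be replaced
by its average. -/
theorem mem_smul_top_of_smul_mem_smul_top (hG : IsPseudoreflectionGroup G)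
    (hcard : IsUnit (Nat.card G : R)) (I : Ideal (invariantRing G)) {a : invariantRing G}
    (ha : a ∉ I) (hI : ∀ b ∈ invariantMaximalIdeal G, b * a ∈ I) (g : MvPolynomial (Fin n) R)
    (hg : a • g ∈ I • (⊤ : Submodule (invariantRing G) (MvPolynomial (Fin n) R))) :
    g ∈ invariantMaximalIdeal G •
      (⊤ : Submodule (invariantRing G) (MvPolynomial (Fin n) R)) := by
  induction hd : g.totalDegree using Nat.strong_induction_on generalizing g with
  | _ d ih =>
  subst hd
  set N := invariantMaximalIdeal G •
    (⊤ : Submodule (invariantRing G) (MvPolynomial (Fin n) R))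
  have hinv : ∀ σ ∈ G, polyAct σ g - g ∈ N := by
    refine polyAct_sub_mem_of_isPseudoreflectionGroup hG N (fun σ hσ f hf => ?_)
      fun σ hσ hps => ?_
    · exact (polyActLinear G ⟨σ, hσ⟩).apply_mem_smul_of_mem_smul _
        (fun _ _ => Submodule.mem_top) hf
    · obtain ⟨l, D, hD⟩ := exists_dividedDifference G (⟨σ, hσ⟩⁻¹ : G) (by
        rw [inv_inv]; exact hps)
      obtain ⟨h₁, h₂⟩ := hD g
      change polyAct σ⁻¹ g - g = _ at h₁
      rw [h₁]
      have hDN : D g ∈ N := by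
        rcases h₂ with h₂ | h₂
        · rw [h₂]
          exact N.zero_mem
        · refine ih _ h₂ _ ?_ rfl
          rw [← map_smul]
          exact D.apply_mem_smul_of_mem_smul I (fun _ _ => Submodule.mem_top) hg
      exact (LinearMap.mulLeft (invariantRing G) l).apply_mem_smul_of_mem_smul _
        (fun _ _ => Submodule.mem_top) hDN
  have hr : reynolds G hcard g ∈ invariantMaximalIdeal G := by
    have h₁ : a * reynolds G hcard g ∈ I := by
      have := (reynolds G hcard).apply_mem_smul_of_mem_smul I (P := ⊤)
        (fun _ _ => Submodule.mem_top) hg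
      simpa using this
    by_contra h₂
    obtain ⟨y, i, hi, hy⟩ := Ideal.IsMaximal.exists_inv inferInstance h₂
    apply ha
    rw [← one_mul a, ← hy, add_mul, mul_assoc, mul_comm _ a]
    exact I.add_mem (I.mul_mem_left y h₁) (hI i hi)
  rw [← sub_add_cancel g (reynolds G hcard g : MvPolynomial (Fin n) R)]
  refine N.add_mem (sub_reynolds_mem G hcard N hinv) ?_
  have := Submodule.smul_mem_smul hr (Submodule.mem_top (x := (1 : MvPolynomial (Fin n) R)))
  rwa [Algebra.smul_def, mul_one] at this

end Key

/-! ### The number of generators of the irrelevant ideal -/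

section Equivariant

variable {R : Type*} [CommRing R] {n : ℕ} {G : Subgroup (Matrix.GeneralLinearGroup (Fin n) R)}

theorem invariant_smul_eq_mul (a : invariantRing G) (f : MvPolynomial (Fin n) R) :
    a • f = (a : MvPolynomial (Fin n) R) * f := rfl

theorem exists_sum_X_mul_eq_of_constantCoeff_eq_zero {f : MvPolynomial (Fin n) R}
    (hf : constantCoeff f = 0) : ∃ g : Fin n → MvPolynomial (Fin n) R, ∑ k, X k * g k = f := by
  have h : f ∈ Ideal.span (Set.range (X : Fin n → MvPolynomial (Fin n) R)) := by
    rw [← Set.image_univ, mem_ideal_span_X_image]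
    intro m hm
    by_contra! h0
    have : m = 0 := Finsupp.ext fun i => by simpa using h0 i
    subst this
    exact mem_support_iff.1 hm hf
  obtain ⟨g, hg⟩ := Ideal.mem_span_range_iff_exists_fun.1 h
  exact ⟨g, by simpa only [mul_comm] using hg⟩

/-- An invariant `α` without constant term is `∑ xₖ wₖ` for a vector `w` of polynomials such that
the `1`-form `∑ wₖ dxₖ` is invariant: by averaging, the equivariant surjection
`∑ wₖ dxₖ ↦ ∑ xₖ wₖ` remains surjective on invariants. -/
theorem exists_equivariant_sum_X_mul_eq [Fintype G] (hcard : IsUnit (Nat.card G : R))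
    {α : invariantRing G} (hα : α ∈ invariantIrrelevant G) :
    ∃ w : Fin n → MvPolynomial (Fin n) R, ∑ k, X k * w k = (α : MvPolynomial (Fin n) R) ∧
      ∀ τ ∈ G, ∀ j, polyAct τ (w j) = ∑ l, C (τ.val l j) * w l := by
  obtain ⟨g, hg⟩ := exists_sum_X_mul_eq_of_constantCoeff_eq_zero
    (f := (α : MvPolynomial (Fin n) R)) hα
  refine ⟨fun j => C (hcard.unit⁻¹ : Rˣ).val *
    ∑ σ : G, ∑ k, C ((σ.1⁻¹).val k j) * polyAct σ.1 (g k), ?_, fun τ hτ j => ?_⟩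
  · rw [← reynolds_coe G hcard α, coe_reynolds, ← hg]
    rw [Finset.sum_congr rfl fun k _ => mul_left_comm (X k) _ _, ← Finset.mul_sum]
    congr 1
    simp_rw [Finset.mul_sum, map_sum, map_mul, polyAct_X, Finset.sum_mul]
    rw [Finset.sum_comm]
    refine Finset.sum_congr rfl fun σ _ => ?_
    rw [Finset.sum_comm]
    exact Finset.sum_congr rfl fun k _ => Finset.sum_congr rfl fun l _ => by ring
  · have h₁ (σ : G) : ∑ k, C ((σ.1⁻¹).val k j) * polyAct τ (polyAct σ.1 (g k)) =
        ∑ l, C (τ.val l j) * ∑ k, C (((τ * σ.1)⁻¹).val k l) * polyAct (τ * σ.1) (g k) := by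
      have h₂ (k : Fin n) : (σ.1⁻¹).val k j = ∑ l, ((τ * σ.1)⁻¹).val k l * τ.val l j := by
        rw [← Matrix.mul_apply, ← Units.val_mul, mul_inv_rev, inv_mul_cancel_right]
      simp_rw [h₂, polyAct_mul, map_sum, Finset.sum_mul, Finset.mul_sum, map_mul]
      rw [Finset.sum_comm]
      exact Finset.sum_congr rfl fun k _ => Finset.sum_congr rfl fun l _ => by ring
    rw [Finset.sum_congr rfl fun l _ => mul_left_comm (C (τ.val l j)) _ _, ← Finset.mul_sum]
    simp_rw [map_mul, map_sum, map_mul, algHom_C, MvPolynomial.algebraMap_eq, h₁]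
    rw [Finset.sum_comm]
    simp_rw [← Finset.mul_sum]
    refine congrArg (C _ * ·) (Finset.sum_congr rfl fun l _ => congrArg (C _ * ·) ?_)
    exact sum_subgroup_mul_left G hτ fun σ => ∑ k, C ((σ⁻¹).val k l) * polyAct σ (g k)

/-- The group acts on the linear relations between equivariant vectors. -/
theorem sum_polyAct_mul_eq_zero {ι : Type*} [Fintype ι] {w : ι → Fin n → MvPolynomial (Fin n) R}
    {τ : Matrix.GeneralLinearGroup (Fin n) R}
    (hw : ∀ i j, polyAct τ (w i j) = ∑ l, C (τ.val l j) * w i l)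
    {s : ι → MvPolynomial (Fin n) R} (hs : ∀ j, ∑ i, s i * w i j = 0) (k : Fin n) :
    ∑ i, polyAct τ (s i) * w i k = 0 := by
  have h₁ (j : Fin n) : ∑ l, C (τ.val l j) * ∑ i, polyAct τ (s i) * w i l = 0 := by
    have := congrArg (polyAct τ) (hs j)
    simp_rw [map_sum, map_mul, hw, map_zero, Finset.mul_sum] at this
    rw [Finset.sum_comm] at this
    simp_rw [Finset.mul_sum]
    rw [← this]
    exact Finset.sum_congr rfl fun l _ => Finset.sum_congr rfl fun i _ => by ring
  have h₂ : ∑ j, C ((τ⁻¹).val j k) * ∑ l, C (τ.val l j) * ∑ i, polyAct τ (s i) * w i l = 0 :=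
    Finset.sum_eq_zero fun j _ => by rw [h₁, mul_zero]
  have h₃ (j l : Fin n) (y : MvPolynomial (Fin n) R) : C ((τ⁻¹).val j k) * (C (τ.val l j) * y) =
      C (τ.val l j * (τ⁻¹).val j k) * y := by
    rw [map_mul]
    ring
  simp_rw [Finset.mul_sum _ _ (C ((τ⁻¹).val _ k)), h₃] at h₂
  rw [Finset.sum_comm] at h₂
  simp_rw [← Finset.sum_mul, ← map_sum, ← Matrix.mul_apply, ← Units.val_mul, mul_inv_cancel] at h₂
  simpa [Matrix.one_apply] using h₂

/-- More than `n` equivariant vectors of length `n` are linearly dependent over the ring of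
invariants. -/
theorem exists_invariant_relation [IsDomain R] [Fintype G] (hcard : IsUnit (Nat.card G : R))
    {ι : Type*} [Fintype ι] (hι : n < Fintype.card ι)
    {w : ι → Fin n → MvPolynomial (Fin n) R}
    (hw : ∀ i, ∀ τ ∈ G, ∀ j, polyAct τ (w i j) = ∑ l, C (τ.val l j) * w i l) :
    ∃ a : ι → invariantRing G, (∃ i, a i ≠ 0) ∧
      ∀ j, ∑ i, (a i : MvPolynomial (Fin n) R) * w i j = 0 := by
  classical
  have hdep : ¬ LinearIndependent (MvPolynomial (Fin n) R) w := fun h => by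
    have := h.fintype_card_le_finrank
    rw [Module.finrank_fin_fun] at this
    omega
  obtain ⟨s, hs, i₀, hi₀⟩ := Fintype.not_linearIndependent_iff.1 hdep
  replace hs (j : Fin n) : ∑ i, s i * w i j = 0 := by
    simpa using congrFun hs j
  -- multiplying by the other conjugates of `s i₀` turns this coefficient into its norm
  set t := ∏ σ ∈ Finset.univ.erase (1 : G), polyAct σ.1 (s i₀)
  have ht : t * s i₀ = ∏ σ : G, polyAct σ.1 (s i₀) := by
    rw [← Finset.prod_erase_mul _ _ (Finset.mem_univ (1 : G)), OneMemClass.coe_one, polyAct_one,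
      AlgHom.id_apply]
  have hmem : t * s i₀ ∈ invariantRing G := by
    rw [ht, mem_invariantRing]
    intro τ hτ
    simp_rw [map_prod, ← polyAct_mul]
    exact Fintype.prod_equiv (Equiv.mulLeft (⟨τ, hτ⟩ : G)) (fun σ : G => polyAct (τ * σ.1) (s i₀))
      (fun σ => polyAct σ.1 (s i₀)) fun _ => rfl
  refine ⟨fun i => reynolds G hcard (t * s i), ⟨i₀, fun h => ?_⟩, fun j => ?_⟩
  · have h₁ := reynolds_coe G hcard ⟨_, hmem⟩
    replace h : reynolds G hcard (t * s i₀) = 0 := h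
    rw [h] at h₁
    have h₂ : t * s i₀ = 0 := (congrArg Subtype.val h₁).symm
    rw [ht, Finset.prod_eq_zero_iff] at h₂
    obtain ⟨σ, -, hσ⟩ := h₂
    exact hi₀ ((map_eq_zero_iff _ (polyAct_injective σ.1)).1 hσ)
  · simp_rw [coe_reynolds, mul_assoc, ← Finset.mul_sum, Finset.sum_mul]
    rw [Finset.sum_comm, Finset.sum_eq_zero, mul_zero]
    intro σ _
    exact sum_polyAct_mul_eq_zero (fun i => hw i σ.1 σ.2)
      (fun j => by simp_rw [mul_assoc, ← Finset.mul_sum, hs, mul_zero]) j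

theorem sum_mul_eq_sum_reynolds [Fintype G] (hcard : IsUnit (Nat.card G : R)) {ι : Type*} [Fintype ι]
    {α : ι → invariantRing G} {w : ι → Fin n → MvPolynomial (Fin n) R}
    (hw : ∀ i, ∑ k, X k * w i k = (α i : MvPolynomial (Fin n) R)) (c : ι → invariantRing G) :
    ∑ i, c i * α i = ∑ k, reynolds G hcard (X k * ∑ i, c i • w i k) := by
  rw [← map_sum, ← reynolds_coe G hcard (∑ i, c i * α i)]
  congr 1
  simp_rw [Finset.mul_sum]
  rw [Finset.sum_comm, AddSubmonoidClass.coe_finsetSum]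
  refine Finset.sum_congr rfl fun i _ => ?_
  rw [MulMemClass.coe_mul, ← hw i, Finset.mul_sum]
  exact Finset.sum_congr rfl fun k _ => by rw [invariant_smul_eq_mul, mul_left_comm]

theorem mem_invariantIrrelevant {a : invariantRing G} :
    a ∈ invariantIrrelevant G ↔ constantCoeff (a : MvPolynomial (Fin n) R) = 0 := Iff.rfl

theorem reynolds_X_mul_mem_irrelevant [Fintype G] (hcard : IsUnit (Nat.card G : R)) (k : Fin n)
    (y : MvPolynomial (Fin n) R) : reynolds G hcard (X k * y) ∈ invariantIrrelevant G := by
  rw [mem_invariantIrrelevant, constantCoeff_reynolds, map_mul, constantCoeff_X, zero_mul]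

theorem reynolds_X_mul_mem_smul [Fintype G] (hcard : IsUnit (Nat.card G : R))
    (I : Ideal (invariantRing G)) (k : Fin n) {y : MvPolynomial (Fin n) R}
    (hy : y ∈ I • (⊤ : Submodule (invariantRing G) (MvPolynomial (Fin n) R))) :
    reynolds G hcard (X k * y) ∈ I • invariantIrrelevant G := by
  let φ : MvPolynomial (Fin n) R →ₗ[invariantRing G] MvPolynomial (Fin n) R :=
    LinearMap.mulLeft (invariantRing G) (X k)
  have h₁ : φ y ∈ I • Submodule.map φ ⊤ :=
    φ.apply_mem_smul_of_mem_smul I (fun z hz => Submodule.mem_map_of_mem hz) hy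
  refine (reynolds G hcard).apply_mem_smul_of_mem_smul I ?_ h₁
  rintro _ ⟨z, -, rfl⟩
  exact reynolds_X_mul_mem_irrelevant hcard k z

end Equivariant

/-- Let `a` be a finite family, not identically zero, in a domain with a maximal ideal `𝔫`. There
is an ideal `I` such that `(a) / (I ∩ (a))` is the residue field of `𝔫`, generated by one of the
`a i₀`. -/
theorem exists_ideal_of_ne_zero {A : Type*} [CommRing A] [IsDomain A] (𝔫 : Ideal A)
    [𝔫.IsMaximal] {ι : Type*} [Fintype ι] {a : ι → A} (ha : ∃ i, a i ≠ 0) :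
    ∃ (I : Ideal A) (i₀ : ι) (c : ι → A), a i₀ ∉ I ∧ (∀ b ∈ 𝔫, b * a i₀ ∈ I) ∧ c i₀ ∉ 𝔫 ∧
      ∀ i, a i - c i * a i₀ ∈ I := by
  classical
  set M : Ideal A := Ideal.span (Set.range a)
  have haM (i : ι) : a i ∈ M := Ideal.subset_span ⟨i, rfl⟩
  have hM : ¬ M ≤ 𝔫 • M := fun h => by
    obtain ⟨r, hr, hrM⟩ := Submodule.exists_sub_one_mem_and_smul_eq_zero_of_fg_of_le_smul 𝔫 M
      (Submodule.fg_span (Set.finite_range a)) h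
    obtain ⟨i, hi⟩ := ha
    have hr0 : r = 0 := by simpa [hi] using hrM _ (haM i)
    rw [hr0, zero_sub] at hr
    exact Ideal.IsMaximal.ne_top inferInstance
      ((Ideal.eq_top_iff_one 𝔫).2 (neg_mem_iff.1 hr))
  -- a maximal subfamily which does not span `M` modulo `𝔫 M`
  let P : Finset ι → Ideal A := fun J => Ideal.span (a '' J) ⊔ 𝔫 • M
  obtain ⟨J, hJ⟩ := (Set.toFinite {J : Finset ι | ¬ M ≤ P J}).exists_maximal
    ⟨∅, by simpa [P] using hM⟩
  -- by maximality, any `a i₀` outside its span generates `M` modulo `P J`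
  obtain ⟨i₀, hi₀⟩ : ∃ i, a i ∉ P J := by
    by_contra! h
    exact hJ.prop (Ideal.span_le.2 (Set.range_subset_iff.2 h))
  have hins : M ≤ P (insert i₀ J) := by
    by_contra h
    have := hJ.le_of_ge (y := insert i₀ J) h (Finset.subset_insert _ _)
    exact hi₀ (Ideal.mem_sup_left (Ideal.subset_span
      ⟨i₀, this (Finset.mem_insert_self _ _), rfl⟩))
  have h𝔫 (b : A) (hb : b ∈ 𝔫) : b * a i₀ ∈ P J :=
    Ideal.mem_sup_right (Submodule.smul_mem_smul hb (haM i₀))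
  have hc (i : ι) : ∃ c, a i - c * a i₀ ∈ P J := by
    have := hins (haM i)
    simp only [P, Finset.coe_insert, Set.image_insert_eq, Ideal.span_insert, sup_assoc] at this
    obtain ⟨x, hx, y, hy, hxy⟩ := Submodule.mem_sup.1 this
    obtain ⟨c, rfl⟩ := Ideal.mem_span_singleton'.1 hx
    exact ⟨c, by rwa [← hxy, add_sub_cancel_left]⟩
  choose c hc using hc
  refine ⟨P J, i₀, c, hi₀, h𝔫, fun h => hi₀ ?_, hc⟩
  simpa using (P J).add_mem (hc i₀) (h𝔫 _ h)

theorem smul_sum_smul_eq_neg {A M ι : Type*} [CommRing A] [AddCommGroup M] [Module A M]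
    [Fintype ι] {a : ι → A} {w : ι → M} (c : ι → A) (h : ∑ i, a i • w i = 0) (b : A) :
    b • ∑ i, c i • w i = - ∑ i, (a i - c i * b) • w i := by
  simp_rw [sub_smul, Finset.sum_sub_distrib, h, Finset.smul_sum, smul_smul, mul_comm (c _)]
  simp

section Rank

variable {R : Type*} [CommRing R] [IsDomain R] [IsDiscreteValuationRing R] {n : ℕ}
  {G : Subgroup (Matrix.GeneralLinearGroup (Fin n) R)} [Fintype G]

/-- The irrelevant ideal `A₊` of the ring of invariants needs locally at `𝔫` at most `n`
generators: more than `n` of its elements are linearly dependent modulo `𝔫 A₊`. -/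
theorem exists_sum_mul_mem_smul_irrelevant (hG : IsPseudoreflectionGroup G)
    (hcard : IsUnit (Nat.card G : R)) {ι : Type*} [Fintype ι] (hι : n < Fintype.card ι)
    {α : ι → invariantRing G} (hα : ∀ i, α i ∈ invariantIrrelevant G) :
    ∃ c : ι → invariantRing G, (∃ i, c i ∉ invariantMaximalIdeal G) ∧
      ∑ i, c i * α i ∈ invariantMaximalIdeal G • invariantIrrelevant G := by
  choose w hwα hw using fun i => exists_equivariant_sum_X_mul_eq hcard (hα i)
  obtain ⟨a, ha, hrel⟩ := exists_invariant_relation hcard hι hw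
  obtain ⟨I, i₀, c, hi₀, hI, hc₀, hc⟩ := exists_ideal_of_ne_zero (invariantMaximalIdeal G) ha
  refine ⟨c, ⟨i₀, hc₀⟩, ?_⟩
  have hy (k : Fin n) : ∑ i, c i • w i k ∈ invariantMaximalIdeal G •
      (⊤ : Submodule (invariantRing G) (MvPolynomial (Fin n) R)) := by
    refine mem_smul_top_of_smul_mem_smul_top hG hcard I hi₀ hI _ ?_
    rw [smul_sum_smul_eq_neg c (by simp_rw [invariant_smul_eq_mul]; exact hrel k)]
    exact Submodule.neg_mem _ (Submodule.sum_mem _ fun i _ =>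
      Submodule.smul_mem_smul (hc i) Submodule.mem_top)
  rw [sum_mul_eq_sum_reynolds hcard hwα]
  refine Submodule.sum_mem _ fun k _ => ?_
  exact reynolds_X_mul_mem_smul hcard _ k (hy k)

end Rank

/-! ### Homogeneous generators of the ring of invariants -/

/-- A maximal independent family modulo `𝔫 P` in a set `H` generates `H` modulo `𝔫 P`. -/
theorem exists_generators_of_dependent {A : Type*} [CommRing A] (𝔫 P : Ideal A) [𝔫.IsMaximal]
    {H : Set A} (hHP : H ⊆ P) (n : ℕ)
    (h : ∀ α : Fin (n + 1) → A, (∀ i, α i ∈ H) →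
      ∃ c : Fin (n + 1) → A, (∃ i, c i ∉ 𝔫) ∧ ∑ i, c i * α i ∈ 𝔫 • P) :
    ∃ (m : ℕ) (f : Fin m → A), m ≤ n ∧ (∀ i, f i ∈ H) ∧
      ∀ b ∈ H, b ∈ Ideal.span (Set.range f) ⊔ 𝔫 • P := by
  let Q : ℕ → Prop := fun m => ∃ f : Fin m → A, (∀ i, f i ∈ H) ∧
    ∀ c : Fin m → A, ∑ i, c i * f i ∈ 𝔫 • P → ∀ i, c i ∈ 𝔫
  obtain ⟨m, hm, ⟨f, hfH, hf⟩, hQ⟩ : ∃ m ≤ n, Q m ∧ ¬ Q (m + 1) := by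
    by_contra! hcon
    have hall : ∀ m ≤ n + 1, Q m := fun m => by
      induction m with
      | zero => exact fun _ => ⟨Fin.elim0, fun i => i.elim0, fun _ _ i => i.elim0⟩
      | succ m ih => exact fun hm => hcon m (by omega) (ih (by omega))
    obtain ⟨α, hα, hind⟩ := hall (n + 1) le_rfl
    obtain ⟨c, ⟨i, hi⟩, hc⟩ := h α hα
    exact hi (hind c hc i)
  refine ⟨m, f, hm, hfH, fun b hb => ?_⟩
  by_contra hbn
  refine hQ ⟨Fin.cons b f, Fin.cases hb hfH, fun c hc => ?_⟩
  rw [Fin.sum_univ_succ] at hc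
  simp only [Fin.cons_zero, Fin.cons_succ] at hc
  have hc0 : c 0 ∈ 𝔫 := by
    by_contra hc0
    obtain ⟨y, i, hi, hy⟩ := Ideal.IsMaximal.exists_inv inferInstance hc0
    have h₁ : b = -∑ j : Fin m, y * c j.succ * f j +
        (y * (c 0 * b + ∑ j : Fin m, c j.succ * f j) + i * b) := by
      have h₂ : i * b = b - y * (c 0 * b) := by linear_combination b * hy
      rw [h₂]
      simp_rw [mul_add, Finset.mul_sum, mul_assoc]
      ring
    rw [h₁] at hbn
    refine hbn (Submodule.add_mem_sup (neg_mem (sum_mem fun j _ =>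
      Ideal.mul_mem_left _ _ (Ideal.subset_span ⟨j, rfl⟩))) (add_mem (Ideal.mul_mem_left _ _ hc) ?_))
    exact Submodule.smul_mem_smul hi (hHP hb)
  have hb' : c 0 * b ∈ 𝔫 • P := Submodule.smul_mem_smul hc0 (hHP hb)
  exact Fin.cases hc0 (hf (fun j => c j.succ) ((Ideal.add_mem_iff_right _ hb').1 hc))

/-- The homogeneous component of degree `d` of a product `p q` lies in any submodule containing the
products of the components of `p` and `q` whose degrees add up to `d`. -/
theorem homogeneousComponent_mul_mem {R ι : Type*} [CommRing R]
    {N : Submodule R (MvPolynomial ι R)} {p q : MvPolynomial ι R} {d : ℕ}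
    (h : ∀ i j, i + j = d → homogeneousComponent i p * homogeneousComponent j q ∈ N) :
    homogeneousComponent d (p * q) ∈ N := by
  have h₁ : p * q = (∑ i ∈ Finset.range (p.totalDegree + 1), homogeneousComponent i p) *
      ∑ j ∈ Finset.range (q.totalDegree + 1), homogeneousComponent j q := by
    rw [sum_homogeneousComponent, sum_homogeneousComponent]
  rw [h₁, Finset.sum_mul_sum, map_sum]
  refine N.sum_mem fun i _ => ?_
  rw [map_sum]
  refine N.sum_mem fun j _ => ?_
  rw [homogeneousComponent_of_mem ((homogeneousComponent_isHomogeneous i p).mul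
    (homogeneousComponent_isHomogeneous j q))]
  split_ifs with hd
  · exact h i j hd.symm
  · exact N.zero_mem

section Generators

variable {R : Type*} [CommRing R] {n : ℕ} {G : Subgroup (Matrix.GeneralLinearGroup (Fin n) R)}

theorem homogeneousComponent_mem_invariantRing {f : MvPolynomial (Fin n) R}
    (hf : f ∈ invariantRing G) (d : ℕ) : homogeneousComponent d f ∈ invariantRing G := by
  rw [mem_invariantRing] at hf ⊢
  intro σ hσ
  rw [← homogeneousComponent_polyAct, hf σ hσ]

theorem homogeneousComponent_zero_of_mem_irrelevant {a : invariantRing G}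
    (ha : a ∈ invariantIrrelevant G) :
    homogeneousComponent 0 (a : MvPolynomial (Fin n) R) = 0 := by
  rw [homogeneousComponent_zero, ← constantCoeff_eq, mem_invariantIrrelevant.1 ha, map_zero]

theorem mem_invariantIrrelevant_of_isHomogeneous {a : invariantRing G} {d : ℕ} (hd : 0 < d)
    (ha : (a : MvPolynomial (Fin n) R).IsHomogeneous d) : a ∈ invariantIrrelevant G :=
  mem_invariantIrrelevant.2 (ha.coeff_eq_zero (by simpa using hd.ne))

/-- Homogeneous invariants of positive degree which span `A₊` modulo `𝔫 A₊` generate the ring of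
invariants: in each degree this is Nakayama's lemma over `R`. -/
theorem adjoin_eq_invariantRing [IsNoetherianRing R] [IsLocalRing R] {m : ℕ}
    {f : Fin m → invariantRing G} {d : Fin m → ℕ} (hd : ∀ i, 0 < d i)
    (hf : ∀ i, (f i : MvPolynomial (Fin n) R).IsHomogeneous (d i))
    (hspan : ∀ (b : invariantRing G) (e : ℕ), 0 < e →
      (b : MvPolynomial (Fin n) R).IsHomogeneous e →
      b ∈ Ideal.span (Set.range f) ⊔ invariantMaximalIdeal G • invariantIrrelevant G) :
    Algebra.adjoin R (Set.range fun i => (f i : MvPolynomial (Fin n) R)) = invariantRing G := by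
  set T := Algebra.adjoin R (Set.range fun i => (f i : MvPolynomial (Fin n) R))
  have hfT (i : Fin m) : (f i : MvPolynomial (Fin n) R) ∈ T := Algebra.subset_adjoin ⟨i, rfl⟩
  refine le_antisymm (Algebra.adjoin_le (by rintro _ ⟨i, rfl⟩; exact (f i).2)) ?_
  suffices h : ∀ e, ∀ a : invariantRing G,
      homogeneousComponent e (a : MvPolynomial (Fin n) R) ∈ T by
    intro a ha
    rw [← sum_homogeneousComponent a]
    exact T.sum_mem fun e _ => h e ⟨a, ha⟩
  intro e
  induction e using Nat.strong_induction_on with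
  | _ e ih =>
  rcases Nat.eq_zero_or_pos e with rfl | he
  · intro a
    rw [homogeneousComponent_zero]
    exact T.algebraMap_mem _
  let B : Submodule R (MvPolynomial (Fin n) R) :=
    Subalgebra.toSubmodule (invariantRing G) ⊓ homogeneousSubmodule (Fin n) R e
  have hBfg : B.FG := by
    have := isNoetherian_of_fg_of_noetherian _ (homogeneousSubmodule_fg (Fin n) R e)
    exact Submodule.FG.of_le (homogeneousSubmodule_fg (Fin n) R e) inf_le_right
  have hcompB (a : invariantRing G) : homogeneousComponent e (a : MvPolynomial (Fin n) R) ∈ B :=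
    ⟨homogeneousComponent_mem_invariantRing a.2 e, homogeneousComponent_isHomogeneous e _⟩
  have hfcomp (i : Fin m) (j : ℕ) :
      homogeneousComponent j (f i : MvPolynomial (Fin n) R) ∈ T := by
    rw [homogeneousComponent_of_mem (hf i)]
    split_ifs
    · exact hfT i
    · exact T.zero_mem
  set N := Subalgebra.toSubmodule T ⊔ IsLocalRing.maximalIdeal R • B
  have hTN : Subalgebra.toSubmodule T ≤ N := le_sup_left
  have hleft (c : invariantRing G) (i : Fin m) :
      homogeneousComponent e (c * f i : MvPolynomial (Fin n) R) ∈ N := by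
    refine homogeneousComponent_mul_mem fun k l hkl => hTN ?_
    rcases Nat.eq_zero_or_pos l with rfl | hl
    · rw [homogeneousComponent_zero_of_mem_irrelevant
        (mem_invariantIrrelevant_of_isHomogeneous (hd i) (hf i)), mul_zero]
      exact T.zero_mem
    · exact T.mul_mem (ih k (by omega) c) (hfcomp i l)
  have hright {c a : invariantRing G} (hc : c ∈ invariantMaximalIdeal G)
      (ha : a ∈ invariantIrrelevant G) :
      homogeneousComponent e (c * a : MvPolynomial (Fin n) R) ∈ N := by
    refine homogeneousComponent_mul_mem fun k l hkl => ?_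
    rcases Nat.eq_zero_or_pos l with rfl | hl
    · rw [homogeneousComponent_zero_of_mem_irrelevant ha, mul_zero]
      exact N.zero_mem
    rcases Nat.eq_zero_or_pos k with rfl | hk
    · obtain rfl : l = e := by omega
      rw [homogeneousComponent_zero, ← smul_eq_C_mul]
      exact Submodule.mem_sup_right (Submodule.smul_mem_smul hc (hcompB a))
    · exact hTN (T.mul_mem (ih k (by omega) c) (ih l (by omega) a))
  have hBT : B ≤ Subalgebra.toSubmodule T := by
    refine Submodule.le_of_le_smul_of_le_jacobson_bot hBfg
      (IsLocalRing.maximalIdeal_le_jacobson ⊥) fun b hb => ?_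
    obtain ⟨x, hx, z, hz, hxz⟩ := Submodule.mem_sup.1 (hspan ⟨b, hb.1⟩ e he hb.2)
    obtain ⟨c, rfl⟩ := Ideal.mem_span_range_iff_exists_fun.1 hx
    replace hxz : ((∑ i, c i * f i + z : invariantRing G) : MvPolynomial (Fin n) R) = b :=
      congrArg Subtype.val hxz
    rw [AddMemClass.coe_add, AddSubmonoidClass.coe_finsetSum] at hxz
    rw [← homogeneousComponent_eq_self hb.2, ← hxz, map_add, map_sum]
    refine N.add_mem (N.sum_mem fun i _ => hleft (c i) i) ?_
    refine Submodule.smul_induction_on hz (fun c hc a ha => hright hc ha) fun y y' hy hy' => ?_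
    rw [AddMemClass.coe_add, map_add]
    exact N.add_mem hy hy'
  exact fun a => hBT (hcompB a)

end Generators

/-! ### Algebraic independence and the grading -/

theorem isIntegral_invariantRing {R : Type*} [CommRing R] {n : ℕ}
    (G : Subgroup (Matrix.GeneralLinearGroup (Fin n) R)) [Finite G] :
    Algebra.IsIntegral (invariantRing G) (MvPolynomial (Fin n) R) := by
  let action : MulSemiringAction G (MvPolynomial (Fin n) R) :=
    { smul := fun σ f => polyAct σ.1 f
      one_smul := fun f => DFunLike.congr_fun polyAct_one f
      mul_smul := fun σ τ f => polyAct_mul σ.1 τ.1 f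
      smul_zero := fun σ => map_zero (polyAct σ.1)
      smul_add := fun σ => map_add (polyAct σ.1)
      smul_one := fun σ => map_one (polyAct σ.1)
      smul_mul := fun σ => map_mul (polyAct σ.1) }
  have comm : SMulCommClass G (invariantRing G) (MvPolynomial (Fin n) R) :=
    ⟨fun σ a f => (polyActLinear G σ).map_smul a f⟩
  have inv : Algebra.IsInvariant (invariantRing G) (MvPolynomial (Fin n) R) G :=
    ⟨fun b hb => ⟨⟨b, (mem_invariantRing G b).2 fun σ hσ => hb ⟨σ, hσ⟩⟩, rfl⟩⟩
  exact Algebra.IsInvariant.isIntegral (invariantRing G) (MvPolynomial (Fin n) R) G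

/-- Homogeneous generators of a subalgebra of a polynomial ring over which the latter is
algebraic are algebraically independent if there are at most as many of them as variables; they
present the subalgebra as a graded polynomial ring. -/
theorem isGradedPolynomialRing_of_adjoin_eq {R : Type*} [CommRing R] [IsDomain R] {n m : ℕ}
    (hmn : m ≤ n) {f : Fin m → MvPolynomial (Fin n) R} {d : Fin m → ℕ} (hd : ∀ i, 0 < d i)
    (hf : ∀ i, (f i).IsHomogeneous (d i)) {S : Subalgebra R (MvPolynomial (Fin n) R)}
    (hS : Algebra.adjoin R (Set.range f) = S) [Algebra.IsAlgebraic S (MvPolynomial (Fin n) R)] :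
    IsGradedPolynomialRing S := by
  subst hS
  have hbasis : IsTranscendenceBasis R f := by
    refine Algebra.IsAlgebraic.isTranscendenceBasis_of_lift_le_trdeg_of_finite R f ?_
    rw [MvPolynomial.trdeg_of_isDomain]
    simpa using hmn
  obtain rfl : m = n := by
    have := hbasis.lift_cardinalMk_eq_trdeg
    rw [MvPolynomial.trdeg_of_isDomain] at this
    simpa using this
  have hhom {p : MvPolynomial (Fin m) R} {k : ℕ} (hp : p.IsWeightedHomogeneous d k) :
      (aeval f p).IsHomogeneous k := by
    rw [← mem_homogeneousSubmodule, aeval_def, eval₂_eq]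
    refine Submodule.sum_mem _ fun s hs => ?_
    rw [MvPolynomial.algebraMap_eq, mem_homogeneousSubmodule]
    refine IsHomogeneous.C_mul ?_ _
    have hk : ∑ i ∈ s.support, d i * s i = k := by
      rw [← hp (mem_support_iff.1 hs), Finsupp.weight_apply, Finsupp.sum]
      simp [mul_comm]
    rw [← hk]
    exact IsHomogeneous.prod _ _ _ fun i _ => (hf i).pow _
  refine ⟨d, hd, hbasis.1.aevalEquiv, fun p k => ⟨hhom, fun hp => ?_⟩⟩
  replace hp : (aeval f p).IsHomogeneous k := hp
  suffices h : weightedHomogeneousComponent d k p = p by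
    rw [← h]
    exact weightedHomogeneousComponent_isWeightedHomogeneous k p
  apply hbasis.1
  have hcomp (q : MvPolynomial (Fin m) R) : aeval f (weightedHomogeneousComponent d k q) =
      homogeneousComponent k (aeval f q) := by
    induction q using MvPolynomial.induction_on' with
    | monomial s r =>
      have hs := isWeightedHomogeneous_monomial d s r rfl
      rw [weightedHomogeneousComponent_of_mem hs, homogeneousComponent_of_mem (hhom hs)]
      split_ifs
      · rfl
      · exact map_zero _
    | add p q hp hq => rw [map_add, map_add, hp, hq, map_add, map_add]
  exact (hcomp p).trans (homogeneousComponent_eq_self hp)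

theorem mainTheorem8 {R : Type*} [CommRing R] [IsDomain R] [IsDiscreteValuationRing R] (n : ℕ)
    (G : Subgroup (Matrix.GeneralLinearGroup (Fin n) R)) [Finite G]
    (hG : IsPseudoreflectionGroup G) (hcard : IsUnit (Nat.card G : R)) :
    IsGradedPolynomialRing (invariantRing G) := by
  have := Fintype.ofFinite G
  let H : Set (invariantRing G) :=
    {a | ∃ d, 0 < d ∧ (a : MvPolynomial (Fin n) R).IsHomogeneous d}
  have hH : H ⊆ invariantIrrelevant G := fun a ⟨_, hd, ha⟩ =>
    mem_invariantIrrelevant_of_isHomogeneous hd ha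
  obtain ⟨m, f, hmn, hfH, hspan⟩ := exists_generators_of_dependent (invariantMaximalIdeal G)
    (invariantIrrelevant G) hH n fun α hα =>
      exists_sum_mul_mem_smul_irrelevant hG hcard (by simp) fun i => hH (hα i)
  choose d hd hf using hfH
  have := isIntegral_invariantRing G
  exact isGradedPolynomialRing_of_adjoin_eq hmn hd hf
    (adjoin_eq_invariantRing hd hf fun b e he hb => hspan b ⟨e, he, hb⟩)
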